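/- **Theorem 1.1.** Let $a\in\mathbb{Q}$, $c=-a-a^2$ and $f(x)=x^2+c$. Write $a=\frac rs$ with $r,s\in\mathbb{Z}$, $s>0$ and $\gcd(r,s)=1$. Assume that $$a\in(-\infty,-2)\cup(-2,-1)\cup(-1,0)\cup(0,\beta)\cup(1,\infty),\qquad \beta=\tfrac13\left(-2+(19-3\sqrt{33})^{1/3}+(19+3\sqrt{33})^{1/3}\right)\approx 0.839,$$ and put $\delta=1$ if $a\in(0,\beta)$, and $\delta=0$ if $a\in(-\infty,-2)\cup(-2,-1)\cup(-1,0)\cup(1,\infty)$. Put $e=0$ if $v_2(a)\le 0$ and $e=1$ if $v_2(a)>0$, where $v_2$ is the $2$-adic valuation. Suppose that $a-c$ is not a square in $\mathbb{Q}$ and that at least one of the following holds: 1. $(-1)^\delta 2^e|r|\equiv 2 \pmod 3$; 2. $(-1)^\delta 2^e|r|\equiv 3 \pmod 4$; 3. $(-1)^\delta 2^e|r|$ is not a quadratic residue modulo $q$ for some prime $q$ dividing $s$. Let $\overline{\mathbb{Q}}$ be an algebraic closure of $\mathbb{Q}$, and let $T$ be the rooted tree with root $a$ whose vertices at level $n\ge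 0$ are the elements of $f^{-n}(a)=\{y\in\overline{\mathbb{Q}} : f^n(y)=a\}$ ($f^n$ denoting the $n$-th iterate), with an edge between each $y\in f^{-(n+1)}(a)$ and $f(y)\in f^{-n}(a)$. Let $\mathrm{Aut}(T)$ be the group of graph automorphisms of $T$ that fix the root. Then $T$ is the regular binary rooted tree (every vertex has exactly two children), and the arboreal Galois representation $$\mathrm{Gal}(\overline{\mathbb{Q}}/\mathbb{Q})\to\mathrm{Aut}(T),$$ given by the action of $\mathrm{Gal}(\overline{\mathbb{Q}}/\mathbb{Q})$ on the vertices of $T$, is surjective. -/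

import Mathlib

/-! Iterated preimage trees of polynomials and arboreal Galois representations. -/

namespace Arboreal

open Polynomial

noncomputable section

variable {K : Type*} [Field K]

/-- The self-map of the algebraic closure of `K` given by a polynomial `f` over `K`. -/
def polyMap (f : K[X]) (x : AlgebraicClosure K) : AlgebraicClosure K := aeval x f

/-- The vertices of the preimage tree `T` of `a` under `f`. The vertices at level `n` are the
elements of `f⁻ⁿ(a)` in the algebraic closure, so that the vertices taken together are
the points of the backward orbit of `a`, recorded with their level. -/
def Vertex (f : K[X]) (a : K) : Type _ :=
  Σ n : ℕ, {β : AlgebraicClosure K // (polyMap f)^[n] β = algebraMap K (AlgebraicClosure K) a}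

namespace Vertex

variable {f : K[X]} {a : K}

/-- The level of a vertex. -/
def level (v : Vertex f a) : ℕ := v.1

/-- The element of the algebraic closure of `K` at a vertex. -/
def point (v : Vertex f a) : AlgebraicClosure K := v.2.1

theorem iterate_point (v : Vertex f a) :
    (polyMap f)^[v.level] v.point = algebraMap K (AlgebraicClosure K) a := v.2.2

theorem ext_iff {v w : Vertex f a} : v = w ↔ v.level = w.level ∧ v.point = w.point := by
  constructor
  · rintro rfl
    exact ⟨rfl, rfl⟩
  · rcases v with ⟨n, x, hx⟩
    rcases w with ⟨m, y, hy⟩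
    rintro ⟨h1, h2⟩
    change n = m at h1
    change x = y at h2
    subst h1
    subst h2
    rfl

/-- `w` is a child of `v`: it lies one level further from the root, and `f` maps it to `v`. -/
def IsChild (v w : Vertex f a) : Prop :=
  w.level = v.level + 1 ∧ polyMap f w.point = v.point

end Vertex

/-- The root of the tree: the point `a` at level `0`. -/
def root (f : K[X]) (a : K) : Vertex f a := ⟨0, algebraMap K (AlgebraicClosure K) a, rfl⟩

/-- The preimage tree `T`, as a graph: there is an edge between `β` at level `n + 1` and `f(β)` at
level `n`. -/
def tree (f : K[X]) (a : K) : SimpleGraph (Vertex f a) where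
  Adj v w := v.IsChild w ∨ w.IsChild v
  symm := ⟨fun _ _ h => h.symm⟩
  loopless := ⟨fun v h => by rcases h with h | h <;> exact absurd h.1 (by omega)⟩

/-- `T` is the regular `d`-ary rooted tree: every vertex has exactly `d` children. -/
def IsRegularTree (d : ℕ) (f : K[X]) (a : K) : Prop :=
  ∀ v : Vertex f a, {w : Vertex f a | v.IsChild w}.ncard = d

/-- `Aut(T)`, the group of automorphisms of the rooted tree `T`: the graph automorphisms that fix
the root. -/
def treeAut (f : K[X]) (a : K) : Subgroup (tree f a ≃g tree f a) where
  carrier := {φ | φ (root f a) = root f a}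
  one_mem' := rfl
  mul_mem' := by
    intro φ ψ hφ hψ
    change φ (ψ (root f a)) = root f a
    rw [show ψ (root f a) = root f a from hψ]
    exact hφ
  inv_mem' := by
    intro φ hφ
    change φ.symm (root f a) = root f a
    rw [RelIso.symm_apply_eq]
    exact (show φ (root f a) = root f a from hφ).symm

theorem polyMap_galois (f : K[X]) (σ : AlgebraicClosure K ≃ₐ[K] AlgebraicClosure K) (x : AlgebraicClosure K) :
    polyMap f (σ x) = σ (polyMap f x) :=
  aeval_algHom_apply σ x f

theorem polyMap_iterate_galois (f : K[X]) (σ : AlgebraicClosure K ≃ₐ[K] AlgebraicClosure K) (n : ℕ)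
    (x : AlgebraicClosure K) : (polyMap f)^[n] (σ x) = σ ((polyMap f)^[n] x) := by
  induction n generalizing x with
  | zero => rfl
  | succ n ih => rw [Function.iterate_succ_apply, Function.iterate_succ_apply, polyMap_galois, ih]

/-- The action of a Galois automorphism on the vertices: `σ` sends `β ∈ f⁻ⁿ(a)` to
`σ(β) ∈ f⁻ⁿ(a)`. -/
def galoisVertex (f : K[X]) (a : K) (σ : AlgebraicClosure K ≃ₐ[K] AlgebraicClosure K) (v : Vertex f a) :
    Vertex f a :=
  ⟨v.level, σ v.point, by rw [polyMap_iterate_galois, v.iterate_point]; exact σ.commutes a⟩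

theorem galoisVertex_isChild (f : K[X]) (a : K) (σ : AlgebraicClosure K ≃ₐ[K] AlgebraicClosure K)
    (v w : Vertex f a) :
    (galoisVertex f a σ v).IsChild (galoisVertex f a σ w) ↔ v.IsChild w := by
  change (w.level = v.level + 1 ∧ polyMap f (σ w.point) = σ v.point) ↔ _
  rw [polyMap_galois, EmbeddingLike.apply_eq_iff_eq]
  rfl

/-- The automorphism of the graph `T` induced by a Galois automorphism. -/
def galoisIso (f : K[X]) (a : K) (σ : AlgebraicClosure K ≃ₐ[K] AlgebraicClosure K) :
    tree f a ≃g tree f a where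
  toFun := galoisVertex f a σ
  invFun := galoisVertex f a σ⁻¹
  left_inv v := Vertex.ext_iff.2 ⟨rfl, σ.symm_apply_apply v.point⟩
  right_inv v := Vertex.ext_iff.2 ⟨rfl, σ.apply_symm_apply v.point⟩
  map_rel_iff' := by
    intro v w
    exact or_congr (galoisVertex_isChild f a σ v w) (galoisVertex_isChild f a σ w v)

/-- The arboreal Galois representation `Gal(K̄/K) → Aut(T)` attached to `f` and `a`. -/
def arborealRep (f : K[X]) (a : K) : (AlgebraicClosure K ≃ₐ[K] AlgebraicClosure K) →* treeAut f a where
  toFun σ := ⟨galoisIso f a σ, Vertex.ext_iff.2 ⟨rfl, σ.commutes a⟩⟩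
  map_one' := rfl
  map_mul' _ _ := rfl

/-- The real number `β ≈ 0.839`. -/
def beta : ℝ :=
  (1 / 3) * (-2 + (19 - 3 * Real.sqrt 33) ^ (1 / 3 : ℝ) + (19 + 3 * Real.sqrt 33) ^ (1 / 3 : ℝ))

end

end Arboreal

/-! The plan is to reduce surjectivity to a statement about squares in `ℚ`, and to prove that
statement from the fact that `a ↦ -a ↦ -a` under `f`.

Galois side (over any field `K` of characteristic zero, `f = X ^ 2 + c`). By compactness of the
absolute Galois group it suffices to reach a tree automorphism level by level, so what is needed is
that automorphisms fixing the tree up to level `n` can change the signs of the square roots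
`√(α - c)`, for `α` at level `n`, arbitrarily (`AllSigns`). The sign vectors that occur form a
Galois-stable subspace of `𝔽₂^(level n)`. The Galois group acts on level `n` transitively and through
a `2`-group, so if the subspace is proper, then the invariant all-ones functional vanishes on it
(`sum_eq_zero_of_isPGroup_two`). This means that the product `∏ √(α - c)`, a square root of
`D n = critDiff c a n`, is fixed by all automorphisms fixing the tree up to level `n`. A second
induction, using the same transitivity, shows that the only elements of `K` becoming squares over
the field generated by the tree up to level `n` are the products of `D 0, …, D (n - 1)`, up to
squares (`exists_subset_mul_prod_fixed`). So all sign vectors occur if no `D n` is a square times a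
product of distinct earlier ones (`allSigns_of_independent`).

Arithmetic side. For `n ≥ 1` we have `D n = fⁿ(c) - a`, and up to a square this is `r * num r s n`.
If a prime divides `fⁿ(c) - a` then modulo this prime the critical orbit lands on the fixed point
`-a` at the next step, so apart from the prime `2` the numerators are coprime to each other and
to `r` (`isCoprime_of_dvd_num`). Hence if `D n` were dependent on its predecessors, then the odd
part of `num r s n` would be a square up to sign, and `r * num r s n = (-1) ^ δ * 2 ^ e * |r| * y ^ 2`
for an integer `y`: the power of `2` is controlled by the parity of `r` and `s`, and the sign by the
real dynamics of the critical orbit (`iterate_succ_gt`, `iterate_succ_lt`). But `r * num r s n`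
is `1` modulo `3` (if `3 ∤ r`) and modulo `4` (if `r` is odd), and it is a nonzero square modulo
every prime dividing `s`, so each of the three congruence conditions excludes this
(`mul_num_succ_ne`). -/

namespace Arboreal

open Polynomial

/-! ### Two-groups acting on vectors over `𝔽₂` -/

/-- A proper subgroup `M` of `𝔽₂^X`, stable under a `2`-group acting transitively on `X`, lies in
the hyperplane of vectors with coordinate sum `0`. The annihilator of `M` is a nonzero `𝔽₂`-vector
space on which the `2`-group acts, so it contains a nonzero invariant vector, which has to be the
all-ones vector by transitivity. -/
theorem sum_eq_zero_of_isPGroup_two {G X : Type*} [Group G] [MulAction G X]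
    [MulAction.IsPretransitive G X] [Fintype X] (hG : IsPGroup 2 G)
    (M : AddSubgroup (X → ZMod 2))
    (hM : ∀ (g : G), ∀ v ∈ M, (fun x => v (g • x)) ∈ M) (hne : M ≠ ⊤) :
    ∀ v ∈ M, ∑ x, v x = 0 := by
  classical
  let A : AddSubgroup (X → ZMod 2) :=
    { carrier := {u | ∀ v ∈ M, ∑ x, u x * v x = 0}
      zero_mem' := by intro v _; simp
      add_mem' := by
        intro u u' hu hu' v hv
        simp only [Pi.add_apply, add_mul, Finset.sum_add_distrib, hu v hv, hu' v hv, add_zero]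
      neg_mem' := by
        intro u hu v hv
        simp only [Pi.neg_apply, neg_mul, Finset.sum_neg_distrib, hu v hv, neg_zero] }
  let act : MulAction G A :=
    { smul := fun g u => ⟨fun x => u.1 (g⁻¹ • x), by
        intro v hv
        have h := u.2 _ (hM g v hv)
        rw [← h]
        exact (Equiv.sum_comp (MulAction.toPerm g : Equiv.Perm X)
          (fun x => u.1 (g⁻¹ • x) * v x)).symm.trans (by simp)⟩
      one_smul := by
        intro u
        apply Subtype.ext
        funext x
        change u.1 ((1 : G)⁻¹ • x) = u.1 x
        simp
      mul_smul := by
        intro g h u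
        apply Subtype.ext
        funext x
        change u.1 ((g * h)⁻¹ • x) = u.1 (h⁻¹ • g⁻¹ • x)
        rw [mul_inv_rev, mul_smul] }
  have hsmul : ∀ (g : G) (u : A) (x : X), (g • u : A).1 x = u.1 (g⁻¹ • x) := fun _ _ _ => rfl
  obtain ⟨u, hu⟩ : ∃ u : A, u ≠ 0 := by
    have hlt : AddSubgroup.toZModSubmodule 2 M < ⊤ := by
      rw [lt_top_iff_ne_top]
      intro h
      apply hne
      ext v
      have : v ∈ AddSubgroup.toZModSubmodule 2 M := h ▸ Submodule.mem_top
      exact ⟨fun _ => trivial, fun _ => this⟩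
    obtain ⟨l, hl, hl'⟩ := Submodule.exists_dual_map_eq_bot_of_lt_top hlt inferInstance
    have hlv : ∀ v : X → ZMod 2, ∑ x, l (Pi.single x 1) * v x = l v := by
      intro v
      conv_rhs => rw [← Finset.univ_sum_single v, map_sum]
      refine Finset.sum_congr rfl fun x _ => ?_
      have : (Pi.single x (v x) : X → ZMod 2) = v x • Pi.single x 1 := by
        rw [← Pi.single_smul]; simp
      rw [this, map_smul, smul_eq_mul, mul_comm]
    refine ⟨⟨fun x => l (Pi.single x 1), ?_⟩, ?_⟩
    · intro v hv
      rw [hlv]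
      have : l v ∈ Submodule.map l (AddSubgroup.toZModSubmodule 2 M) :=
        Submodule.mem_map_of_mem hv
      rwa [hl', Submodule.mem_bot] at this
    · intro h
      apply hl
      refine LinearMap.ext fun v => ?_
      rw [← hlv, LinearMap.zero_apply]
      refine Finset.sum_eq_zero fun x _ => ?_
      rw [show l (Pi.single x 1) = 0 from congr_fun (congr_arg Subtype.val h) x, zero_mul]
  have hcard : 2 ∣ Nat.card A := by
    have h2 : (2 : ℕ) • u = 0 := by
      apply Subtype.ext
      funext x
      change (2 : ℕ) • u.1 x = 0
      rw [nsmul_eq_mul]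
      exact (by decide : ∀ y : ZMod 2, ((2 : ℕ) : ZMod 2) * y = 0) _
    have := addOrderOf_eq_prime h2 hu
    have hdvd := addOrderOf_dvd_natCard u
    rwa [this] at hdvd
  have h0 : (0 : A) ∈ MulAction.fixedPoints G A := fun g => rfl
  obtain ⟨w, hw, hw0⟩ := hG.exists_fixed_point_of_prime_dvd_card_of_fixed_point A hcard h0
  have hconst : ∀ x y, w.1 x = w.1 y := by
    intro x y
    obtain ⟨g, rfl⟩ := MulAction.exists_smul_eq G x y
    have := hsmul g w (g • x)
    rw [hw g, inv_smul_smul] at this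
    exact this.symm
  have hone : ∀ x, w.1 x = 1 := by
    by_contra! h
    obtain ⟨x, hx⟩ := h
    apply hw0
    apply Subtype.ext
    funext y
    rw [hconst y x]
    exact ((by decide : ∀ y : ZMod 2, y ≠ 1 → 0 = y) _ hx)
  intro v hv
  simpa [hone] using w.2 v hv

/-! ### Signs -/

/-- The sign `(-1)^x` attached to `x ∈ 𝔽₂`, as an element of `L`. -/
def sgn (L : Type*) [Ring L] (x : ZMod 2) : L := if x = 0 then 1 else -1

section Sign

variable {L : Type*} [Field L]

@[simp] theorem sgn_zero : sgn L 0 = 1 := if_pos rfl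

@[simp] theorem sgn_one : sgn L 1 = -1 := if_neg (by decide)

theorem zmod_two_eq_zero_or_one : ∀ x : ZMod 2, x = 0 ∨ x = 1 := by decide

theorem sgn_add (x y : ZMod 2) : sgn L (x + y) = sgn L x * sgn L y := by
  rcases zmod_two_eq_zero_or_one x with rfl | rfl <;>
    rcases zmod_two_eq_zero_or_one y with rfl | rfl <;> simp [CharTwo.add_self_eq_zero]

theorem sgn_mul_self (x : ZMod 2) : sgn L x * sgn L x = 1 := by
  rcases zmod_two_eq_zero_or_one x with rfl | rfl <;> simp

theorem sgn_sum {X : Type*} (s : Finset X) (v : X → ZMod 2) :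
    sgn L (∑ x ∈ s, v x) = ∏ x ∈ s, sgn L (v x) := by
  classical
  induction s using Finset.induction_on with
  | empty => simp
  | insert x s hx ih => rw [Finset.sum_insert hx, Finset.prod_insert hx, sgn_add, ih]

theorem map_sgn {M F : Type*} [Field M] [FunLike F L M] [RingHomClass F L M] (σ : F)
    (x : ZMod 2) : σ (sgn L x) = sgn M x := by
  rcases zmod_two_eq_zero_or_one x with rfl | rfl <;> simp

theorem sgn_injective [NeZero (2 : L)] : Function.Injective (sgn L) := by
  have h : (1 : L) ≠ -1 := fun h => two_ne_zero (α := L) (by linear_combination h)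
  intro x y
  rcases zmod_two_eq_zero_or_one x with rfl | rfl <;>
    rcases zmod_two_eq_zero_or_one y with rfl | rfl <;> simp [h, h.symm]

theorem exists_eq_sgn_mul {x y : L} (h : x ^ 2 = y ^ 2) : ∃ e, x = sgn L e * y := by
  rcases sq_eq_sq_iff_eq_or_eq_neg.1 h with h | h
  · exact ⟨0, by simp [h]⟩
  · exact ⟨1, by simp [h]⟩

end Sign

/-! ### The levels of the preimage tree of `X ^ 2 + c` -/

noncomputable section Levels

variable {K : Type*} [Field K]

/-- The set `f⁻ⁿ(a)` of vertices at level `n`, as a subtype of the algebraic closure. -/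
def Level (f : K[X]) (a : K) (n : ℕ) : Type _ :=
  {β : AlgebraicClosure K // (polyMap f)^[n] β = algebraMap K (AlgebraicClosure K) a}

/-- The quadratic polynomial `X ^ 2 + c`. -/
abbrev quad (c : K) : K[X] := X ^ 2 + C c

/-- The elements `a - c` (for `n = 0`) and `fⁿ(c) - a = fⁿ⁺¹(0) - a` (for `n ≥ 1`), where
`f = X ^ 2 + c`. Up to squares, they are the discriminants of the polynomials `fⁿ⁺¹ - a`. -/
def critDiff (c a : K) (n : ℕ) : K :=
  if n = 0 then a - c else (fun x => x ^ 2 + c)^[n] c - a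

/-- A chosen square root of `α - c`, that is, a chosen preimage of `α` under `X ^ 2 + c`. -/
def sqrtSub (c : K) (α : AlgebraicClosure K) : AlgebraicClosure K :=
  (IsAlgClosed.exists_pow_nat_eq (α - algebraMap K (AlgebraicClosure K) c) two_pos).choose

theorem sqrtSub_sq (c : K) (α : AlgebraicClosure K) :
    sqrtSub c α ^ 2 = α - algebraMap K (AlgebraicClosure K) c :=
  (IsAlgClosed.exists_pow_nat_eq (α - algebraMap K (AlgebraicClosure K) c) two_pos).choose_spec

variable {c a : K} {n : ℕ}

theorem polyMap_quad (c : K) (x : AlgebraicClosure K) :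
    polyMap (quad c) x = x ^ 2 + algebraMap K (AlgebraicClosure K) c := by
  simp [polyMap]

theorem polyMap_quad_iterate_algebraMap (c x : K) (n : ℕ) :
    (polyMap (quad c))^[n] (algebraMap K (AlgebraicClosure K) x) =
      algebraMap K (AlgebraicClosure K) ((fun x => x ^ 2 + c)^[n] x) := by
  induction n generalizing x with
  | zero => rfl
  | succ n ih =>
    rw [Function.iterate_succ_apply, Function.iterate_succ_apply, ← ih, polyMap_quad]
    simp

instance (f : K[X]) (a : K) (n : ℕ) :
    MulAction (AlgebraicClosure K ≃ₐ[K] AlgebraicClosure K) (Level f a n) where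
  smul σ β := ⟨σ β.1, by rw [polyMap_iterate_galois, β.2]; exact σ.commutes a⟩
  one_smul _ := rfl
  mul_smul _ _ _ := rfl

theorem Level.coe_smul {f : K[X]} (σ : AlgebraicClosure K ≃ₐ[K] AlgebraicClosure K)
    (β : Level f a n) : (σ • β).1 = σ β.1 := rfl

/-- The parent `f(β)` of a vertex `β` at a positive level. -/
def Level.parent {f : K[X]} (β : Level f a (n + 1)) : Level f a n :=
  ⟨polyMap f β.1, by rw [← Function.iterate_succ_apply]; exact β.2⟩

theorem Level.parent_smul {f : K[X]} (σ : AlgebraicClosure K ≃ₐ[K] AlgebraicClosure K)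
    (β : Level f a (n + 1)) : (σ • β).parent = σ • β.parent :=
  Subtype.ext (polyMap_galois f σ β.1)

/-- The child `± √(α - c)` of the vertex `α`, where the sign is given by an element of `𝔽₂`. -/
def Level.child (α : Level (quad c) a n) (e : ZMod 2) : Level (quad c) a (n + 1) :=
  ⟨sgn _ e * sqrtSub c α.1, by
    have : polyMap (quad c) (sgn _ e * sqrtSub c α.1) = α.1 := by
      rw [polyMap_quad, mul_pow, sq (sgn _ e), sgn_mul_self, sqrtSub_sq]; ring
    rw [Function.iterate_succ_apply, this]
    exact α.2⟩

theorem Level.parent_child (α : Level (quad c) a n) (e : ZMod 2) : (α.child e).parent = α := by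
  apply Subtype.ext
  change polyMap (quad c) (sgn _ e * sqrtSub c α.1) = α.1
  rw [polyMap_quad, mul_pow, sq (sgn _ e), sgn_mul_self, sqrtSub_sq]; ring

theorem Level.exists_eq_child (β : Level (quad c) a (n + 1)) : ∃ e, β = β.parent.child e := by
  have h : β.1 ^ 2 = sqrtSub c β.parent.1 ^ 2 := by
    rw [sqrtSub_sq]
    change _ = polyMap (quad c) β.1 - _
    rw [polyMap_quad]; ring
  obtain ⟨e, he⟩ := exists_eq_sgn_mul h
  exact ⟨e, Subtype.ext he⟩

instance Level.finite : ∀ n, Finite (Level (quad c) a n)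
  | 0 => by
    have : Subsingleton (Level (quad c) a 0) :=
      ⟨fun x y => Subtype.ext (x.2.trans y.2.symm)⟩
    infer_instance
  | n + 1 => by
    have := Level.finite n
    refine Finite.of_surjective (α := Level (quad c) a n × ZMod 2) (fun p => p.1.child p.2) ?_
    intro β
    obtain ⟨e, he⟩ := β.exists_eq_child
    exact ⟨(β.parent, e), he.symm⟩

instance : Fintype (Level (quad c) a n) := Fintype.ofFinite _

theorem sub_ne_zero_of_critDiff_ne_zero (hD : critDiff c a n ≠ 0) (α : Level (quad c) a n) :
    α.1 - algebraMap K (AlgebraicClosure K) c ≠ 0 := by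
  intro h
  apply hD
  have h1 := α.2
  rw [sub_eq_zero.1 h, polyMap_quad_iterate_algebraMap] at h1
  have h2 := (algebraMap K (AlgebraicClosure K)).injective h1
  unfold critDiff
  split_ifs with hn
  · subst hn
    rw [← h2]
    simp
  · rw [h2, sub_self]

theorem sqrtSub_ne_zero (hD : critDiff c a n ≠ 0) (α : Level (quad c) a n) :
    sqrtSub c α.1 ≠ 0 := by
  intro h
  apply sub_ne_zero_of_critDiff_ne_zero hD α
  rw [← sqrtSub_sq, h]
  simp

variable [CharZero K]

/-- The vertices at level `n + 1` are the two children of each vertex at level `n`. -/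
def levelSuccEquiv (hD : critDiff c a n ≠ 0) :
    Level (quad c) a n × ZMod 2 ≃ Level (quad c) a (n + 1) :=
  Equiv.ofBijective (fun p => p.1.child p.2) <| by
    constructor
    · rintro ⟨α, e⟩ ⟨α', e'⟩ h
      have h1 : α = α' := by
        have := congr_arg Level.parent h
        simpa only [Level.parent_child] using this
      subst h1
      have h2 : sgn _ e * sqrtSub c α.1 = sgn _ e' * sqrtSub c α.1 := congr_arg Subtype.val h
      rw [sgn_injective (mul_right_cancel₀ (sqrtSub_ne_zero hD α) h2)]
    · intro β
      obtain ⟨e, he⟩ := β.exists_eq_child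
      exact ⟨(β.parent, e), he.symm⟩

theorem card_level (hD : ∀ k < n, critDiff c a k ≠ 0) :
    Fintype.card (Level (quad c) a n) = 2 ^ n := by
  induction n with
  | zero =>
    have : Unique (Level (quad c) a 0) :=
      { default := ⟨algebraMap K _ a, rfl⟩, uniq := fun x => Subtype.ext x.2 }
    exact Fintype.card_unique
  | succ n ih =>
    rw [← Fintype.card_congr (levelSuccEquiv (hD n n.lt_succ_self)), Fintype.card_prod,
      ih fun k hk => hD k (by omega), ZMod.card, pow_succ]

/-- The points of level `n` are the simple roots of `fⁿ - a`. -/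
theorem prod_sub_level (hD : ∀ k < n, critDiff c a k ≠ 0) (x : AlgebraicClosure K) :
    ∏ α : Level (quad c) a n, (x - α.1) =
      (polyMap (quad c))^[n] x - algebraMap K (AlgebraicClosure K) a := by
  induction n generalizing x with
  | zero =>
    let _ : Unique (Level (quad c) a 0) :=
      { default := ⟨algebraMap K _ a, rfl⟩, uniq := fun x => Subtype.ext x.2 }
    rw [Fintype.prod_unique]
    rfl
  | succ n ih =>
    rw [← Equiv.prod_comp (levelSuccEquiv (hD n n.lt_succ_self)), Fintype.prod_prod_type,
      Function.iterate_succ_apply, ← ih fun k hk => hD k (by omega)]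
    refine Finset.prod_congr rfl fun α _ => ?_
    have h2 : ∀ g : ZMod 2 → AlgebraicClosure K, ∏ e, g e = g 0 * g 1 := fun g =>
      Fin.prod_univ_two g
    rw [h2]
    change (x - sgn _ 0 * sqrtSub c α.1) * (x - sgn _ 1 * sqrtSub c α.1) = _
    have := sqrtSub_sq c α.1
    rw [polyMap_quad, sgn_zero, sgn_one]
    linear_combination -this

/-- The product of the chosen square roots of `α - c`, for `α` at level `n`: a square root of
`critDiff c a n`. -/
def sqrtProd (c a : K) (n : ℕ) : AlgebraicClosure K :=
  ∏ α : Level (quad c) a n, sqrtSub c α.1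

theorem sqrtProd_sq (hD : ∀ k < n, critDiff c a k ≠ 0) :
    sqrtProd c a n ^ 2 = algebraMap K (AlgebraicClosure K) (critDiff c a n) := by
  rw [sqrtProd, ← Finset.prod_pow]
  have h : ∏ α : Level (quad c) a n, sqrtSub c α.1 ^ 2 =
      ∏ α : Level (quad c) a n, (-1) * (algebraMap K (AlgebraicClosure K) c - α.1) :=
    Finset.prod_congr rfl fun α _ => by rw [sqrtSub_sq]; ring
  rw [h, Finset.prod_mul_distrib, prod_sub_level hD, Finset.prod_const, Finset.card_univ,
    card_level hD, polyMap_quad_iterate_algebraMap, ← map_sub, critDiff]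
  split_ifs with hn
  · subst hn
    simp
  · rw [Even.neg_one_pow ((Nat.even_pow.2 ⟨even_two, hn⟩)), one_mul]

/-- If no `critDiff c a k` vanishes, then every vertex has exactly two children. -/
theorem isRegularTree_two (hD : ∀ n, critDiff c a n ≠ 0) : IsRegularTree 2 (quad c) a := by
  rintro ⟨n, α⟩
  change Level (quad c) a n at α
  let g : Level (quad c) a (n + 1) → Vertex (quad c) a := fun β => ⟨n + 1, β⟩
  have hg : ∀ e e', g (α.child e) = g (α.child e') → e = e' := by
    intro e e' h
    have h1 : α.child e = α.child e' := Subtype.ext (Vertex.ext_iff.1 h).2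
    have h2 : (α, e) = (α, e') := (levelSuccEquiv (hD n)).injective h1
    exact congr_arg Prod.snd h2
  have : {w : Vertex (quad c) a | Vertex.IsChild ⟨n, α⟩ w} =
      {g (α.child 0), g (α.child 1)} := by
    ext w
    constructor
    · rintro ⟨h1, h2⟩
      obtain ⟨m, β⟩ := w
      change m = n + 1 at h1
      subst h1
      change Level (quad c) a (n + 1) at β
      obtain ⟨e, he⟩ := β.exists_eq_child
      rw [show β.parent = α from Subtype.ext h2] at he
      rcases zmod_two_eq_zero_or_one e with rfl | rfl
      · exact Or.inl (congr_arg g he)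
      · exact Or.inr (congr_arg g he)
    · have key : ∀ e, Vertex.IsChild ⟨n, α⟩ (g (α.child e)) := fun e =>
        ⟨rfl, congr_arg Subtype.val (α.parent_child e)⟩
      rintro (h | h) <;> rw [h] <;> exact key _
  rw [this]
  exact Set.ncard_pair fun h => by simpa using hg _ _ h

end Levels

/-! ### Sign vectors of Galois automorphisms -/

theorem funToZModTwo_add_self {X : Type*} (v : X → ZMod 2) : v + v = 0 :=
  funext fun _ => CharTwo.add_self_eq_zero _

noncomputable section Signs

variable {K : Type*} [Field K] {c a : K} {n : ℕ}

/-- The Galois automorphisms fixing all vertices of level at most `n`. -/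
def levelFixer (c a : K) (n : ℕ) : Subgroup Gal(AlgebraicClosure K/K) where
  carrier := {σ | ∀ k ≤ n, ∀ β : Level (quad c) a k, σ β.1 = β.1}
  one_mem' _ _ _ := rfl
  mul_mem' := by
    intro σ τ hσ hτ k hk β
    rw [AlgEquiv.mul_apply, hτ k hk, hσ k hk]
  inv_mem' := by
    intro σ hσ k hk β
    conv_lhs => rw [← hσ k hk β]
    exact σ.symm_apply_apply _

theorem mem_levelFixer_zero (σ : Gal(AlgebraicClosure K/K)) : σ ∈ levelFixer c a 0 := by
  intro k hk β
  obtain rfl := Nat.le_zero.1 hk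
  have hβ : β.1 = algebraMap K _ a := β.2
  rw [hβ]
  exact σ.commutes a

theorem conj_mem_levelFixer {τ : Gal(AlgebraicClosure K/K)} (hτ : τ ∈ levelFixer c a n)
    (σ : Gal(AlgebraicClosure K/K)) : σ * τ * σ⁻¹ ∈ levelFixer c a n := by
  intro k hk β
  rw [AlgEquiv.mul_apply, AlgEquiv.mul_apply, ← Level.coe_smul σ⁻¹, hτ k hk, ← Level.coe_smul,
    smul_inv_smul]

/-- `τ` multiplies the square root of `α - c` by the sign `v α`, for all `α` at level `n`. -/
def HasSigns (τ : Gal(AlgebraicClosure K/K)) (v : Level (quad c) a n → ZMod 2) : Prop :=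
  ∀ α, τ (sqrtSub c α.1) = sgn _ (v α) * sqrtSub c α.1

theorem exists_hasSigns {τ : Gal(AlgebraicClosure K/K)} (hτ : τ ∈ levelFixer c a n) :
    ∃ v : Level (quad c) a n → ZMod 2, HasSigns τ v := by
  have : ∀ α : Level (quad c) a n, ∃ e, τ (sqrtSub c α.1) = sgn _ e * sqrtSub c α.1 := by
    intro α
    apply exists_eq_sgn_mul
    rw [← map_pow, sqrtSub_sq, map_sub, hτ n le_rfl, AlgEquiv.commutes]
  exact Classical.axiom_of_choice this

theorem HasSigns.mul {τ τ' : Gal(AlgebraicClosure K/K)} {v v' : Level (quad c) a n → ZMod 2}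
    (h : HasSigns τ v) (h' : HasSigns τ' v') : HasSigns (τ * τ') (v + v') := by
  intro α
  rw [AlgEquiv.mul_apply, h', map_mul, map_sgn, h, Pi.add_apply, sgn_add]
  ring

theorem HasSigns.inv {τ : Gal(AlgebraicClosure K/K)} {v : Level (quad c) a n → ZMod 2}
    (h : HasSigns τ v) : HasSigns τ⁻¹ v := by
  intro α
  have : sqrtSub c α.1 = τ (sgn _ (v α) * sqrtSub c α.1) := by
    rw [map_mul, map_sgn, h, ← mul_assoc, sgn_mul_self, one_mul]
  conv_lhs => rw [this]
  exact τ.symm_apply_apply _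

theorem HasSigns.conj {τ : Gal(AlgebraicClosure K/K)} {v : Level (quad c) a n → ZMod 2}
    (h : HasSigns τ v) (σ : Gal(AlgebraicClosure K/K)) :
    HasSigns (σ * τ * σ⁻¹) (fun α => v (σ⁻¹ • α)) := by
  intro α
  obtain ⟨e, he⟩ : ∃ e, σ⁻¹ (sqrtSub c α.1) = sgn _ e * sqrtSub c (σ⁻¹ • α).1 := by
    apply exists_eq_sgn_mul
    rw [← map_pow, sqrtSub_sq, sqrtSub_sq, map_sub, AlgEquiv.commutes, Level.coe_smul]
  have h2 : τ (σ⁻¹ (sqrtSub c α.1)) = sgn _ (v (σ⁻¹ • α)) * σ⁻¹ (sqrtSub c α.1) := by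
    rw [he, map_mul, map_sgn, h]
    ring
  rw [AlgEquiv.mul_apply, AlgEquiv.mul_apply, h2, map_mul, map_sgn]
  congr 1
  exact σ.apply_symm_apply _

theorem HasSigns.apply_child {τ : Gal(AlgebraicClosure K/K)} {v : Level (quad c) a n → ZMod 2}
    (h : HasSigns τ v) (α : Level (quad c) a n) (e : ZMod 2) :
    τ (α.child e).1 = (α.child (v α + e)).1 := by
  change τ (sgn _ e * sqrtSub c α.1) = sgn _ (v α + e) * sqrtSub c α.1
  rw [map_mul, map_sgn, h, sgn_add]
  ring

theorem HasSigns.mem_levelFixer_succ {τ : Gal(AlgebraicClosure K/K)}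
    (hτ : τ ∈ levelFixer c a n) (h : HasSigns τ (0 : Level (quad c) a n → ZMod 2)) :
    τ ∈ levelFixer c a (n + 1) := by
  intro k hk β
  rcases Nat.le_succ_iff.1 hk with hk | rfl
  · exact hτ k hk β
  · obtain ⟨e, he⟩ := β.exists_eq_child
    rw [he, h.apply_child, Pi.zero_apply, zero_add]

theorem HasSigns.apply_sqrtProd {τ : Gal(AlgebraicClosure K/K)}
    {v : Level (quad c) a n → ZMod 2} (h : HasSigns τ v) :
    τ (sqrtProd c a n) = sgn _ (∑ α, v α) * sqrtProd c a n := by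
  rw [sqrtProd, map_prod, sgn_sum, ← Finset.prod_mul_distrib]
  exact Finset.prod_congr rfl fun α _ => h α

theorem pow_two_pow_mem_levelFixer (σ : Gal(AlgebraicClosure K/K)) (n : ℕ) :
    σ ^ 2 ^ n ∈ levelFixer c a n := by
  induction n with
  | zero => exact mem_levelFixer_zero _
  | succ n ih =>
    obtain ⟨v, hv⟩ := exists_hasSigns ih
    rw [pow_succ, pow_mul, sq]
    refine HasSigns.mem_levelFixer_succ (mul_mem ih ih) ?_
    have := hv.mul hv
    rwa [funToZModTwo_add_self] at this

/-- Every sign vector on level `n` is realized by an automorphism fixing all vertices up to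
level `n`. Equivalently, the elements `α - c`, for `α` at level `n`, are independent modulo squares
over the field generated by the vertices up to level `n`. -/
def AllSigns (c a : K) (n : ℕ) : Prop :=
  ∀ v : Level (quad c) a n → ZMod 2, ∃ τ ∈ levelFixer c a n, HasSigns τ v

theorem isPretransitive_level (h : ∀ k < n, AllSigns c a k) :
    MulAction.IsPretransitive Gal(AlgebraicClosure K/K) (Level (quad c) a n) := by
  induction n with
  | zero => exact ⟨fun x y => ⟨1, Subtype.ext (x.2.trans y.2.symm)⟩⟩
  | succ n ih =>
    have := ih fun k hk => h k (by omega)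
    refine ⟨fun x y => ?_⟩
    obtain ⟨σ, hσ⟩ := MulAction.exists_smul_eq Gal(AlgebraicClosure K/K) x.parent y.parent
    obtain ⟨e, he⟩ := (σ • x).exists_eq_child
    obtain ⟨e', he'⟩ := y.exists_eq_child
    rw [Level.parent_smul, hσ] at he
    obtain ⟨τ, -, hτ⟩ := h n n.lt_succ_self (fun _ => e' + e)
    refine ⟨τ * σ, Subtype.ext ?_⟩
    rw [mul_smul, Level.coe_smul, he, hτ.apply_child, add_assoc, CharTwo.add_self_eq_zero,
      add_zero, ← he']

/-- If not all sign vectors on level `n` are realized, then the Galois action on the tree up to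
level `n` fixes the square root of `critDiff c a n`. -/
theorem apply_sqrtProd_of_not_allSigns (h : ∀ k < n, AllSigns c a k) (hn : ¬ AllSigns c a n)
    {τ : Gal(AlgebraicClosure K/K)} (hτ : τ ∈ levelFixer c a n) :
    τ (sqrtProd c a n) = sqrtProd c a n := by
  have := isPretransitive_level h
  let R := (MulAction.toPermHom Gal(AlgebraicClosure K/K) (Level (quad c) a n)).range
  have hR : IsPGroup 2 R := by
    rintro ⟨_, σ, rfl⟩
    refine ⟨n, Subtype.ext (Equiv.ext fun β => ?_)⟩
    change ((MulAction.toPermHom _ _ σ) ^ 2 ^ n) β = β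
    rw [← map_pow]
    exact Subtype.ext (pow_two_pow_mem_levelFixer (c := c) (a := a) σ n n le_rfl β)
  have : MulAction.IsPretransitive R (Level (quad c) a n) := by
    refine ⟨fun x y => ?_⟩
    obtain ⟨σ, hσ⟩ := MulAction.exists_smul_eq Gal(AlgebraicClosure K/K) x y
    exact ⟨⟨_, σ, rfl⟩, hσ⟩
  let M : AddSubgroup (Level (quad c) a n → ZMod 2) :=
    { carrier := {v | ∃ τ ∈ levelFixer c a n, HasSigns τ v}
      zero_mem' := ⟨1, one_mem _, fun α => by simp⟩
      add_mem' := by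
        rintro v v' ⟨τ, hτ, h⟩ ⟨τ', hτ', h'⟩
        exact ⟨τ * τ', mul_mem hτ hτ', h.mul h'⟩
      neg_mem' := by
        rintro v ⟨τ, hτ, h⟩
        rw [show -v = v from funext fun x => CharTwo.neg_eq (v x)]
        exact ⟨τ, hτ, h⟩ }
  have hM : ∀ (g : R), ∀ v ∈ M, (fun x => v (g • x)) ∈ M := by
    rintro ⟨_, σ, rfl⟩ v ⟨τ, hτ, h⟩
    have h2 := h.conj σ⁻¹
    rw [inv_inv] at h2
    have h3 := conj_mem_levelFixer hτ σ⁻¹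
    rw [inv_inv] at h3
    exact ⟨_, h3, h2⟩
  have hne : M ≠ ⊤ := fun hM => hn fun v =>
    (show v ∈ M from hM ▸ AddSubgroup.mem_top v)
  obtain ⟨v, hv⟩ := exists_hasSigns hτ
  rw [hv.apply_sqrtProd, sum_eq_zero_of_isPGroup_two hR M hM hne v ⟨τ, hτ, hv⟩, sgn_zero, one_mul]

/-- If all sign vectors on the levels below `n` are realized, then the only elements with square
in `K` in the field generated by the tree up to level `n` are the `K`-multiples of products of
distinct elements `sqrtProd c a i` with `i < n`. -/
theorem exists_subset_mul_prod_fixed [CharZero K] (hD : ∀ k, critDiff c a k ≠ 0)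
    (h : ∀ k < n, AllSigns c a k)
    (y : AlgebraicClosure K) (hy : ∀ σ : Gal(AlgebraicClosure K/K), ∃ e, σ y = sgn _ e * y)
    (hfix : ∀ σ ∈ levelFixer c a n, σ y = y) :
    ∃ S ⊆ Finset.range n, ∀ σ : Gal(AlgebraicClosure K/K),
      σ (y * ∏ i ∈ S, sqrtProd c a i) = y * ∏ i ∈ S, sqrtProd c a i := by
  classical
  induction n generalizing y with
  | zero => exact ⟨∅, by simp, fun σ => by simpa using hfix σ (mem_levelFixer_zero σ)⟩
  | succ n ih =>
    have hn := h n n.lt_succ_self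
    have htr := isPretransitive_level fun k hk => h k (Nat.lt_succ_of_lt hk)
    have ih := ih fun k hk => h k (Nat.lt_succ_of_lt hk)
    -- The action of an element fixing level `n` on `y` is a linear functional of its sign vector,
    -- and by transitivity all coordinates enter this functional with the same coefficient `κ`.
    obtain ⟨κ, hκ⟩ : ∃ κ : ZMod 2, ∀ α : Level (quad c) a n, ∀ τ ∈ levelFixer c a n,
        HasSigns τ (Pi.single α 1) → τ y = sgn _ κ * y := by
      have α₀ : Level (quad c) a n :=
        (Fintype.card_pos_iff.1 (by rw [card_level fun k _ => hD k]; positivity)).some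
      obtain ⟨τ₀, hτ₀, hs₀⟩ := hn (Pi.single α₀ 1)
      obtain ⟨κ, hκ⟩ := hy τ₀
      refine ⟨κ, fun α τ hτ hs => ?_⟩
      obtain ⟨σ, hσ⟩ := MulAction.exists_smul_eq Gal(AlgebraicClosure K/K) α₀ α
      have hs' : HasSigns (σ * τ₀ * σ⁻¹) (Pi.single α 1) := by
        convert hs₀.conj σ using 1
        funext β
        rw [← hσ]
        simp only [Pi.single_apply, inv_smul_eq_iff]
      have hτ' := conj_mem_levelFixer hτ₀ σ
      have hfix' : ((σ * τ₀ * σ⁻¹)⁻¹ * τ) y = y := by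
        apply hfix
        refine HasSigns.mem_levelFixer_succ (mul_mem (inv_mem hτ') hτ) ?_
        have := hs'.inv.mul hs
        rwa [funToZModTwo_add_self] at this
      have h1 : τ y = (σ * τ₀ * σ⁻¹) y := by
        conv_rhs => rw [← hfix']
        rw [← AlgEquiv.mul_apply, mul_inv_cancel_left]
      rw [h1]
      obtain ⟨e, he⟩ := hy σ⁻¹
      rw [AlgEquiv.mul_apply, AlgEquiv.mul_apply, he, map_mul, map_sgn, hκ, mul_left_comm, ← he,
        map_mul, map_sgn]
      congr 1
      exact σ.apply_symm_apply _
    have hlin : ∀ (s : Finset (Level (quad c) a n)) (v : Level (quad c) a n → ZMod 2),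
        (∀ α ∉ s, v α = 0) → ∀ τ ∈ levelFixer c a n, HasSigns τ v →
        τ y = sgn _ (κ * ∑ α ∈ s, v α) * y := by
      intro s
      induction s using Finset.induction_on with
      | empty =>
        intro v hv τ hτ hs
        obtain rfl : v = 0 := funext fun α => hv α (Finset.notMem_empty α)
        rw [hfix τ (hs.mem_levelFixer_succ hτ)]
        simp
      | insert α s hα ihs =>
        intro v hv τ hτ hs
        rcases zmod_two_eq_zero_or_one (v α) with h0 | h1
        · rw [Finset.sum_insert hα, h0, zero_add]
          refine ihs v (fun β hβ => ?_) τ hτ hs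
          by_cases hβα : β = α
          · rw [hβα, h0]
          · exact hv β (by simp [hβα, hβ])
        · obtain ⟨ρ, hρ, hρs⟩ := hn (Pi.single α 1)
          have h2 := ihs (Pi.single α 1 + v) (fun β hβ => by
            by_cases hβα : β = α
            · rw [hβα, Pi.add_apply, Pi.single_eq_same, h1]; rfl
            · rw [Pi.add_apply, Pi.single_eq_of_ne hβα, hv β (by simp [hβα, hβ]), add_zero])
            (ρ⁻¹ * τ) (mul_mem (inv_mem hρ) hτ) (hρs.inv.mul hs)
          have h3 : ∑ β ∈ s, (Pi.single α 1 + v : Level (quad c) a n → ZMod 2) β =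
              ∑ β ∈ s, v β := by
            refine Finset.sum_congr rfl fun β hβ => ?_
            rw [Pi.add_apply, Pi.single_eq_of_ne (by rintro rfl; exact hα hβ), zero_add]
          rw [h3] at h2
          have h4 : τ y = ρ ((ρ⁻¹ * τ) y) := by rw [← AlgEquiv.mul_apply, mul_inv_cancel_left]
          rw [h4, h2, map_mul, map_sgn, hκ α ρ hρ hρs, Finset.sum_insert hα, h1, mul_add, sgn_add,
            mul_one]
          ring
    have hsq : ∀ σ : Gal(AlgebraicClosure K/K), ∃ e, σ (sqrtProd c a n) =
        sgn _ e * sqrtProd c a n := fun σ => exists_eq_sgn_mul <| by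
      rw [← map_pow, sqrtProd_sq fun k _ => hD k, AlgEquiv.commutes]
    rcases zmod_two_eq_zero_or_one κ with rfl | rfl
    · obtain ⟨S, hS, hS'⟩ := ih y hy fun τ hτ => by
        obtain ⟨v, hv⟩ := exists_hasSigns hτ
        have := hlin Finset.univ v (fun α hα => absurd (Finset.mem_univ α) hα) τ hτ hv
        rwa [zero_mul, sgn_zero, one_mul] at this
      exact ⟨S, hS.trans (Finset.range_mono n.le_succ), hS'⟩
    · obtain ⟨S, hS, hS'⟩ := ih (y * sqrtProd c a n)
        (fun σ => by
          obtain ⟨e, he⟩ := hy σ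
          obtain ⟨e', he'⟩ := hsq σ
          exact ⟨e + e', by rw [map_mul, he, he', sgn_add]; ring⟩)
        (fun τ hτ => by
          obtain ⟨v, hv⟩ := exists_hasSigns hτ
          have := hlin Finset.univ v (fun α hα => absurd (Finset.mem_univ α) hα) τ hτ hv
          rw [map_mul, this, hv.apply_sqrtProd, one_mul, mul_mul_mul_comm, sgn_mul_self, one_mul])
      have hnS : n ∉ S := fun h => by simpa using hS h
      refine ⟨insert n S, ?_, fun σ => ?_⟩
      · rw [Finset.range_add_one]
        exact Finset.insert_subset_insert n hS
      · rw [Finset.prod_insert hnS, ← mul_assoc]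
        exact hS' σ

/-- All sign vectors are realized as soon as no `critDiff c a n` is a square up to a product
of distinct earlier ones. -/
theorem allSigns_of_independent [CharZero K]
    (hD : ∀ n, ∀ S ⊆ Finset.range n, ¬ IsSquare (critDiff c a n * ∏ i ∈ S, critDiff c a i))
    (n : ℕ) : AllSigns c a n := by
  have hD0 : ∀ n, critDiff c a n ≠ 0 := fun n h0 => hD n ∅ (by simp) (by simp [h0])
  induction n using Nat.strong_induction_on with
  | _ n ih =>
    by_contra hn
    obtain ⟨S, hS, hfix⟩ := exists_subset_mul_prod_fixed hD0 ih (sqrtProd c a n)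
      (fun σ => exists_eq_sgn_mul <| by
        rw [← map_pow, sqrtProd_sq fun k _ => hD0 k, AlgEquiv.commutes])
      (fun τ hτ => apply_sqrtProd_of_not_allSigns ih hn hτ)
    obtain ⟨q, hq⟩ := (InfiniteGalois.mem_range_algebraMap_iff_fixed _).2 hfix
    refine hD n S hS ⟨q, (algebraMap K (AlgebraicClosure K)).injective ?_⟩
    rw [map_mul, map_mul, map_prod, hq, ← sq, mul_pow, ← Finset.prod_pow,
      sqrtProd_sq fun k _ => hD0 k]
    congr 1
    exact Finset.prod_congr rfl fun i _ => (sqrtProd_sq fun k _ => hD0 k).symm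

end Signs

/-! ### Surjectivity from the independence of the critical differences -/

noncomputable section Surjectivity

variable {K : Type*} [Field K]

/-- An automorphism of the graph `T` fixing the root preserves levels: the neighbours of a vertex
are its children and its parent, and by induction its parent is mapped to the parent of its image,
so that children have to be mapped to children. -/
theorem level_apply_treeAut {f : K[X]} {a : K} (φ : tree f a ≃g tree f a)
    (hφ : φ (root f a) = root f a) (v : Vertex f a) : (φ v).level = v.level := by
  suffices h : ∀ n, ∀ v : Vertex f a, v.level ≤ n → (φ v).level = v.level from
    h v.level v le_rfl
  have hroot : ∀ v : Vertex f a, v.level = 0 → v = root f a := by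
    rintro ⟨n, x, hx⟩ h
    change n = 0 at h
    subst h
    exact Vertex.ext_iff.2 ⟨rfl, hx⟩
  have hpar : ∀ (v : Vertex f a) (n : ℕ), v.level = n + 1 → ∃ u : Vertex f a, u.IsChild v := by
    rintro ⟨m, x, hx⟩ n h
    change m = n + 1 at h
    subst h
    exact ⟨⟨n, polyMap f x, by rw [← Function.iterate_succ_apply]; exact hx⟩, rfl, rfl⟩
  intro n
  induction n with
  | zero =>
    intro v hv
    rw [hroot v (Nat.le_zero.1 hv), hφ]
  | succ n ih =>
    intro w hw
    rcases Nat.le_succ_iff.1 hw with hw | hw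
    · exact ih w hw
    obtain ⟨v, hv⟩ := hpar w n hw
    have hvn : v.level = n := by have := hv.1; omega
    have hφv := ih v hvn.le
    rcases (φ.map_rel_iff.2 (Or.inl hv : (tree f a).Adj v w) : (tree f a).Adj (φ v) (φ w))
      with h | h
    · have := h.1; omega
    · exfalso
      obtain ⟨m, rfl⟩ : ∃ m, n = m + 1 := ⟨(φ w).level, by have := h.1; omega⟩
      obtain ⟨u, hu⟩ := hpar v m hvn
      have hun : u.level = m := by have := hu.1; omega
      have hφu := ih u (by omega)
      have h3 : (φ u).IsChild (φ v) := by
        rcases (φ.map_rel_iff.2 (Or.inl hu : (tree f a).Adj u v) : (tree f a).Adj (φ u) (φ v))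
          with h' | h'
        · exact h'
        · have := h'.1; omega
      have h4 : φ u = φ w := Vertex.ext_iff.2
        ⟨by have := h3.1; have := h.1; omega, by rw [← h3.2, ← h.2]⟩
      have := congr_arg Vertex.level (φ.injective h4)
      omega

theorem isChild_apply_treeAut {f : K[X]} {a : K} (φ : tree f a ≃g tree f a)
    (hφ : φ (root f a) = root f a) {v w : Vertex f a} (h : v.IsChild w) :
    (φ v).IsChild (φ w) := by
  rcases (φ.map_rel_iff.2 (Or.inl h : (tree f a).Adj v w) : (tree f a).Adj (φ v) (φ w))
    with h' | h'
  · exact h'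
  · have h1 := h'.1
    have h2 := h.1
    rw [level_apply_treeAut φ hφ, level_apply_treeAut φ hφ] at h1
    omega

theorem isClosed_setOf_apply_eq (x y : AlgebraicClosure K) :
    IsClosed {σ : Gal(AlgebraicClosure K/K) | σ x = y} := by
  by_cases h : ∃ σ₀ : Gal(AlgebraicClosure K/K), σ₀ x = y
  · obtain ⟨σ₀, rfl⟩ := h
    have : {σ : Gal(AlgebraicClosure K/K) | σ x = σ₀ x} =
        (fun σ => σ₀⁻¹ * σ) ⁻¹' (MulAction.stabilizer Gal(AlgebraicClosure K/K) x) := by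
      ext σ
      change σ x = σ₀ x ↔ σ₀.symm (σ x) = x
      rw [AlgEquiv.symm_apply_eq]
    rw [this]
    exact (Subgroup.isClosed_of_isOpen _ (stabilizer_isOpen_of_isIntegral x)).preimage
      (continuous_const_mul σ₀⁻¹)
  · push Not at h
    convert isClosed_empty
    ext σ
    simpa using h σ

/-- If no `critDiff c a n` is a square up to a product of distinct earlier ones, then the arboreal
Galois representation of `X ^ 2 + c` with root `a` is surjective. -/
theorem surjective_arborealRep [CharZero K] {c a : K}
    (hD : ∀ n, ∀ S ⊆ Finset.range n, ¬ IsSquare (critDiff c a n * ∏ i ∈ S, critDiff c a i)) :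
    Function.Surjective (arborealRep (quad c) a) := by
  have hD0 : ∀ n, critDiff c a n ≠ 0 := fun n h0 => hD n ∅ (by simp) (by simp [h0])
  rintro ⟨φ, hφ⟩
  change φ (root _ a) = root _ a at hφ
  let t : ℕ → Set Gal(AlgebraicClosure K/K) := fun n =>
    {σ | ∀ v : Vertex (quad c) a, v.level ≤ n → σ v.point = (φ v).point}
  -- An automorphism agreeing with `φ` up to level `n` is corrected on level `n + 1` by one fixing
  -- all vertices up to level `n`.
  have htn : ∀ n, (t n).Nonempty := by
    intro n
    induction n with
    | zero =>
      refine ⟨1, fun v hv => ?_⟩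
      obtain ⟨m, x, hx⟩ := v
      obtain rfl := Nat.le_zero.1 hv
      have : (⟨0, x, hx⟩ : Vertex (quad c) a) = root (quad c) a := Vertex.ext_iff.2 ⟨rfl, hx⟩
      rw [this, hφ]
      rfl
    | succ n ih =>
      obtain ⟨σ, hσ⟩ := ih
      let p : Level (quad c) a n → Vertex (quad c) a := fun α => ⟨n, α⟩
      let g : Level (quad c) a n → ZMod 2 → Vertex (quad c) a := fun α e => ⟨n + 1, α.child e⟩
      have hg : ∀ α e, (p α).IsChild (g α e) := fun α e =>
        ⟨rfl, congr_arg Subtype.val (α.parent_child e)⟩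
      have key : ∀ α e, ∃ e', (φ (g α e)).point = σ (sgn _ e' * sqrtSub c α.1) := by
        intro α e
        have h1 := (isChild_apply_treeAut φ hφ (hg α e)).2
        rw [polyMap_quad, ← hσ (p α) le_rfl] at h1
        change _ = σ α.1 at h1
        have h2 : (φ (g α e)).point ^ 2 = σ (sqrtSub c α.1) ^ 2 := by
          rw [← map_pow, sqrtSub_sq, map_sub, ← h1, AlgEquiv.commutes]; ring
        obtain ⟨e', he'⟩ := exists_eq_sgn_mul h2
        exact ⟨e', by rw [he', map_mul, map_sgn]⟩
      have : ∀ α, ∃ e', ∀ e, (φ (g α e)).point = σ (α.child (e' + e)).1 := by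
        intro α
        obtain ⟨e₀, h₀⟩ := key α 0
        obtain ⟨e₁, h₁⟩ := key α 1
        -- The two children of `α` have distinct images.
        have hne : e₀ ≠ e₁ := by
          rintro rfl
          have h2 : φ (g α 0) = φ (g α 1) := Vertex.ext_iff.2
            ⟨by rw [level_apply_treeAut φ hφ, level_apply_treeAut φ hφ]; rfl, h₀.trans h₁.symm⟩
          have h3 : α.child 0 = α.child 1 :=
            Subtype.ext (Vertex.ext_iff.1 (φ.injective h2)).2
          have h4 : (α, (0 : ZMod 2)) = (α, 1) := (levelSuccEquiv (hD0 n)).injective h3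
          simpa using congr_arg Prod.snd h4
        refine ⟨e₀, fun e => ?_⟩
        rcases zmod_two_eq_zero_or_one e with rfl | rfl
        · rw [h₀, add_zero]; rfl
        · rw [h₁, (by decide : ∀ x y : ZMod 2, x ≠ y → y = x + 1) e₀ e₁ hne]; rfl
      choose v hv using this
      obtain ⟨τ, hτ, hs⟩ := allSigns_of_independent hD n v
      refine ⟨σ * τ, fun w hw => ?_⟩
      rcases Nat.le_succ_iff.1 hw with hw | hw
      · rw [AlgEquiv.mul_apply, ← hσ w hw]
        exact congr_arg σ (hτ w.level hw w.2)
      · obtain ⟨m, β⟩ := w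
        change m = n + 1 at hw
        subst hw
        change Level (quad c) a (n + 1) at β
        obtain ⟨e, he⟩ := β.exists_eq_child
        have h2 := hv β.parent e
        rw [← hs.apply_child, ← he] at h2
        have h3 : g β.parent e = ⟨n + 1, β⟩ := by rw [he, Level.parent_child]
        rw [h3] at h2
        exact h2.symm
  -- By compactness of the Galois group, one automorphism agrees with `φ` on all levels.
  have htcl : ∀ n, IsClosed (t n) := by
    intro n
    have : t n = ⋂ (v : Vertex (quad c) a) (_ : v.level ≤ n),
        {σ : Gal(AlgebraicClosure K/K) | σ v.point = (φ v).point} := by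
      ext σ
      simp only [Set.mem_iInter]
      rfl
    rw [this]
    exact isClosed_iInter fun v => isClosed_iInter fun _ => isClosed_setOf_apply_eq _ _
  obtain ⟨σ, hσ⟩ := IsCompact.nonempty_iInter_of_sequence_nonempty_isCompact_isClosed t
    (fun n σ hσ v hv => hσ v (hv.trans n.le_succ)) htn (htcl 0).isCompact htcl
  refine ⟨σ, Subtype.ext (RelIso.ext fun v => Vertex.ext_iff.2 ⟨?_, ?_⟩)⟩
  · exact (level_apply_treeAut φ hφ v).symm
  · exact Set.mem_iInter.1 hσ v.level v le_rfl

end Surjectivity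

/-! ### Numerators and denominators of the critical orbit -/

/-- The powers `den s n = s ^ (2 ^ (n + 1) - 1)`. With `a = r / s`, `c = -a - a ^ 2` and
`f = X ^ 2 + c`, one has `fⁿ(c) - a = r * num r s n / (s * den s n)`. -/
def den (s : ℤ) : ℕ → ℤ
  | 0 => s
  | n + 1 => s * den s n ^ 2

/-- The numerators in `fⁿ(c) - a = r * num r s n / (s * den s n)`, where `a = r / s`,
`c = -a - a ^ 2` and `f = X ^ 2 + c`. -/
def num (r s : ℤ) : ℕ → ℤ
  | 0 => -(r + 2 * s)
  | n + 1 => r * num r s n * (num r s n + 2 * den s n) - 2 * den s (n + 1)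

/-- A square root of `s * den s n`. -/
def denRoot (s : ℤ) : ℕ → ℤ
  | 0 => s
  | n + 1 => s * den s n

variable {r s : ℤ} {n : ℕ}

theorem denRoot_sq (s : ℤ) : ∀ n, denRoot s n ^ 2 = s * den s n
  | 0 => by simp only [denRoot, den]; ring
  | n + 1 => by simp only [denRoot, den]; ring

theorem den_ne_zero (hs : s ≠ 0) : ∀ n, den s n ≠ 0
  | 0 => hs
  | n + 1 => mul_ne_zero hs (pow_ne_zero 2 (den_ne_zero hs n))

theorem denRoot_ne_zero (hs : s ≠ 0) (n : ℕ) : denRoot s n ≠ 0 := fun h => by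
  have := denRoot_sq s n
  rw [h] at this
  exact mul_ne_zero hs (den_ne_zero hs n) (by linear_combination -this)

theorem dvd_den (s : ℤ) : ∀ n, s ∣ den s n
  | 0 => dvd_rfl
  | _ + 1 => dvd_mul_right _ _

theorem iterate_sub_eq (hs : s ≠ 0) {a c : ℚ} (ha : a = r / s) (hc : c = -a - a ^ 2) (n : ℕ) :
    (fun x => x ^ 2 + c)^[n] c - a = r * num r s n / (s * den s n) := by
  have hs' : (s : ℚ) ≠ 0 := by exact_mod_cast hs
  induction n with
  | zero =>
    simp only [Function.iterate_zero, id, num, den]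
    rw [hc, ha]
    push_cast
    field_simp
    ring
  | succ n ih =>
    have hd : (den s n : ℚ) ≠ 0 := by exact_mod_cast den_ne_zero hs n
    rw [Function.iterate_succ_apply']
    have h : (fun x => x ^ 2 + c)^[n] c = r / s + r * num r s n / (s * den s n) := by
      rw [← ih, ← ha]; ring
    simp only [h, num, den]
    rw [hc, ha]
    push_cast
    field_simp
    ring

theorem num_add_two_mul_den_succ (r s : ℤ) (n : ℕ) :
    num r s (n + 1) + 2 * den s (n + 1) = r * num r s n * (num r s n + 2 * den s n) := by
  simp only [num]; ring

theorem num_dvd_num_add_two_mul_den {i : ℕ} (h : i < n) :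
    r * num r s i ∣ num r s n + 2 * den s n := by
  induction n with
  | zero => omega
  | succ n ih =>
    rw [num_add_two_mul_den_succ]
    rcases Nat.lt_succ_iff_lt_or_eq.1 h with h | rfl
    · exact (ih h).mul_left _
    · exact dvd_mul_right _ _

theorem dvd_num_succ_sub (r s : ℤ) (n : ℕ) : s ∣ num r s (n + 1) - r * num r s n ^ 2 := by
  obtain ⟨k, hk⟩ := dvd_den s n
  refine ⟨2 * r * num r s n * k - 2 * den s n ^ 2, ?_⟩
  simp only [num, den]
  linear_combination 2 * r * num r s n * hk

theorem isCoprime_num_left (h : IsCoprime r s) (n : ℕ) : IsCoprime (num r s n) s := by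
  induction n with
  | zero =>
    have : num r s 0 = -(r + s * 2) := by simp only [num]; ring
    rw [this]
    exact (h.add_mul_left_left 2).neg_left
  | succ n ih =>
    obtain ⟨k, hk⟩ := dvd_num_succ_sub r s n
    have : num r s (n + 1) = r * num r s n ^ 2 + s * k := by linear_combination hk
    rw [this]
    exact (h.mul_left ih.pow_left).add_mul_left_left k

theorem isCoprime_den_right {x : ℤ} (h : IsCoprime x s) : ∀ n, IsCoprime x (den s n)
  | 0 => h
  | n + 1 => h.mul_right (isCoprime_den_right h n).pow_right

/-- An odd divisor of a numerator is coprime to `r` and to all earlier numerators. This is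
because `fⁿ(c) ≡ a` modulo a prime implies `fᵏ(c) ≡ -a` for all `k > n`, as `f(a) = -a`
is a fixed point of `f`. -/
theorem isCoprime_of_dvd_num (h : IsCoprime r s) {x : ℤ} (hx : x ∣ num r s n) (hodd : Odd x)
    {i : ℕ} (hi : i < n) : IsCoprime x (r * num r s i) := by
  have h1 : IsCoprime x (2 * den s n) := by
    refine IsCoprime.mul_right ?_ ?_
    · obtain ⟨k, rfl⟩ := hodd
      exact ⟨1, -k, by ring⟩
    · exact ((isCoprime_den_right (isCoprime_num_left h n)) n).of_isCoprime_of_dvd_left hx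
  obtain ⟨k, hk⟩ := hx
  have h2 : IsCoprime x (num r s n + 2 * den s n) := by
    rw [hk, add_comm]
    exact h1.add_mul_left_right k
  exact h2.of_isCoprime_of_dvd_right (num_dvd_num_add_two_mul_den hi)

theorem odd_num (hr : Odd r) (n : ℕ) : Odd (num r s n) := by
  induction n with
  | zero =>
    simp only [num]
    exact (hr.add_even (even_two_mul s)).neg
  | succ n ih =>
    have : num r s (n + 1) = r * num r s n ^ 2 +
        2 * (r * num r s n * den s n - den s (n + 1)) := by simp only [num]; ring
    rw [this]
    exact (hr.mul ih.pow).add_even (even_two_mul _)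

theorem odd_den (hs : Odd s) : ∀ n, Odd (den s n)
  | 0 => hs
  | n + 1 => hs.mul (odd_den hs n).pow

theorem even_num (hr : Even r) (n : ℕ) : Even (num r s n) := by
  cases n with
  | zero => exact (hr.add (even_two_mul s)).neg
  | succ n =>
    simp only [num]
    exact ((hr.mul_right _).mul_right _).sub (even_two_mul _)

theorem exists_num_succ_eq_two_mul_odd (hr : Even r) (hs : Odd s) (n : ℕ) :
    ∃ w, num r s (n + 1) = 2 * w ∧ Odd w := by
  obtain ⟨k, hk⟩ := even_num (s := s) hr n
  refine ⟨2 * (r * k * (k + den s n)) - den s (n + 1), ?_, ?_⟩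
  · simp only [num, hk]; ring
  · exact (even_two_mul _).sub_odd (odd_den hs _)

/-! ### Congruences for the numerators -/

theorem num_succ_eq_of_sq_eq_one {R : Type*} [CommRing R] (hr : (r : R) ^ 2 = 1)
    (hs : 2 * (s : R) ^ 3 = 2 * s) (hS : ∀ x : R, 2 * x = 2 * s → 2 * (s * x ^ 2) = 2 * s)
    (n : ℕ) : (num r s (n + 1) : R) = r := by
  have hden : ∀ n, 2 * (den s n : R) = 2 * s := by
    intro n
    induction n with
    | zero => rfl
    | succ n ih =>
      simp only [den]
      push_cast
      exact hS _ ih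
  induction n with
  | zero =>
    simp only [num, den]
    push_cast
    linear_combination (r + 2 * s : R) * hr - hs
  | succ n ih =>
    have h1 := hden (n + 1)
    have h2 := hden (n + 2)
    rw [num]
    push_cast
    rw [ih]
    linear_combination (r + 2 * den s (n + 1) : R) * hr + h1 - h2

theorem num_succ_zmod_three (hr : (r : ZMod 3) ≠ 0) (n : ℕ) :
    (num r s (n + 1) : ZMod 3) = r :=
  num_succ_eq_of_sq_eq_one ((by decide : ∀ x : ZMod 3, x ≠ 0 → x ^ 2 = 1) _ hr)
    ((by decide : ∀ x : ZMod 3, 2 * x ^ 3 = 2 * x) _)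
    ((by decide : ∀ s x : ZMod 3, 2 * x = 2 * s → 2 * (s * x ^ 2) = 2 * s) _) n

theorem num_succ_zmod_four (hr : (r : ZMod 4) ^ 2 = 1) (n : ℕ) :
    (num r s (n + 1) : ZMod 4) = r :=
  num_succ_eq_of_sq_eq_one hr
    ((by decide : ∀ x : ZMod 4, 2 * x ^ 3 = 2 * x) _)
    ((by decide : ∀ s x : ZMod 4, 2 * x = 2 * s → 2 * (s * x ^ 2) = 2 * s) _) n

/-- For `ε = ± 2 ^ e * |r|`, each of the three congruence conditions prevents `r * num r s n` with
`n ≥ 1` from being `ε` times a square. -/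
theorem mul_num_succ_ne (h : IsCoprime r s) {δ e : ℕ} {ε : ℤ}
    (hε : ε = (-1) ^ δ * 2 ^ e * |r|)
    (hcong : ε ≡ 2 [ZMOD 3] ∨ ε ≡ 3 [ZMOD 4] ∨
      ∃ q : ℕ, q.Prime ∧ (q : ℤ) ∣ s ∧ ¬ IsSquare (ε : ZMod q)) (n : ℕ) (y : ℤ) :
    r * num r s (n + 1) ≠ ε * y ^ 2 := by
  intro heq
  have hrε : r ∣ ε := hε ▸ (self_dvd_abs r).mul_left _
  rcases hcong with h3 | h4 | ⟨q, hq, hqs, hsq⟩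
  · have h3' := (ZMod.intCast_eq_intCast_iff _ _ 3).2 h3
    push_cast at h3'
    have hr : (r : ZMod 3) ≠ 0 := by
      intro h0
      obtain ⟨k, rfl⟩ := hrε
      rw [Int.cast_mul, h0, zero_mul] at h3'
      exact absurd h3' (by decide)
    have h5 := congr_arg (Int.cast : ℤ → ZMod 3) heq
    push_cast at h5
    rw [num_succ_zmod_three hr, h3'] at h5
    exact (by decide : ∀ x y : ZMod 3, x ≠ 0 → x * x ≠ 2 * y ^ 2) _ _ hr h5
  · have h4' := (ZMod.intCast_eq_intCast_iff _ _ 4).2 h4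
    push_cast at h4'
    have hr : (r : ZMod 4) ^ 2 = 1 := by
      obtain ⟨k, rfl⟩ := hrε
      rw [Int.cast_mul] at h4'
      exact (by decide : ∀ x y : ZMod 4, x * y = 3 → x ^ 2 = 1) _ _ h4'
    have h5 := congr_arg (Int.cast : ℤ → ZMod 4) heq
    push_cast at h5
    rw [num_succ_zmod_four hr, h4', ← sq, hr] at h5
    exact (by decide : ∀ y : ZMod 4, 1 ≠ 3 * y ^ 2) _ h5
  · have : Fact q.Prime := ⟨hq⟩
    have hs0 : (s : ZMod q) = 0 := (ZMod.intCast_zmod_eq_zero_iff_dvd _ _).2 hqs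
    have hcop : ∀ x : ℤ, IsCoprime x s → (x : ZMod q) ≠ 0 := by
      rintro x ⟨u, v, huv⟩ h0
      have := congr_arg (Int.cast : ℤ → ZMod q) huv
      push_cast at this
      rw [h0, hs0] at this
      simp at this
    have hr := hcop r h
    have hn := hcop _ (isCoprime_num_left h n)
    have h5 := congr_arg (Int.cast : ℤ → ZMod q) heq
    obtain ⟨k, hk⟩ := dvd_num_succ_sub r s n
    have h6 := congr_arg (Int.cast : ℤ → ZMod q) hk
    push_cast at h5 h6
    rw [hs0, zero_mul] at h6
    have h7 : ((r : ZMod q) * num r s n) ^ 2 = ε * (y : ZMod q) ^ 2 := by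
      linear_combination h5 - r * h6
    have hy : (y : ZMod q) ≠ 0 := by
      intro h0
      rw [h0, zero_pow two_ne_zero, mul_zero] at h7
      exact mul_ne_zero hr hn (pow_eq_zero_iff two_ne_zero |>.1 h7)
    exact hsq ⟨r * num r s n / y, by field_simp; linear_combination -h7⟩

/-! ### Signs of the critical differences -/

/-- The number `β` is the real root of `x³ + 2x² - 2`, given by Cardano's formula. -/
theorem beta_root : beta ^ 3 + 2 * beta ^ 2 - 2 = 0 := by
  have h33 : Real.sqrt 33 ^ 2 = 33 := Real.sq_sqrt (by norm_num)
  have hnn := Real.sqrt_nonneg 33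
  have hlt : 3 * Real.sqrt 33 < 19 := by nlinarith
  have hcube : ∀ x : ℝ, 0 ≤ x → (x ^ (1 / 3 : ℝ)) ^ 3 = x := fun x hx => by
    rw [← Real.rpow_natCast, ← Real.rpow_mul hx]
    norm_num
  have hu := hcube (19 - 3 * Real.sqrt 33) (by linarith)
  have hv := hcube (19 + 3 * Real.sqrt 33) (by linarith)
  have hu0 : 0 ≤ (19 - 3 * Real.sqrt 33) ^ (1 / 3 : ℝ) := Real.rpow_nonneg (by linarith) _
  have hv0 : 0 ≤ (19 + 3 * Real.sqrt 33) ^ (1 / 3 : ℝ) := Real.rpow_nonneg (by linarith) _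
  unfold beta
  generalize (19 - 3 * Real.sqrt 33) ^ (1 / 3 : ℝ) = u at *
  generalize (19 + 3 * Real.sqrt 33) ^ (1 / 3 : ℝ) = v at *
  have huv : u * v = 4 := by
    refine (pow_left_inj₀ (mul_nonneg hu0 hv0) (by norm_num) three_ne_zero).1 ?_
    rw [mul_pow, hu, hv]
    linear_combination -9 * h33
  linear_combination (1 / 27 : ℝ) * hu + (1 / 27 : ℝ) * hv + (1 / 9 : ℝ) * (u + v) * huv

theorem cubic_neg_of_lt_beta {a : ℚ} (ha : 0 < a) (hβ : (a : ℝ) < beta) :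
    a ^ 3 + 2 * a ^ 2 - 2 < 0 := by
  have h0 : (0 : ℝ) < a := by exact_mod_cast ha
  have h2 : (a : ℝ) ^ 2 < beta ^ 2 := pow_lt_pow_left₀ hβ h0.le two_ne_zero
  have h3 : (a : ℝ) ^ 3 < beta ^ 3 := pow_lt_pow_left₀ hβ h0.le three_ne_zero
  have : (a : ℝ) ^ 3 + 2 * (a : ℝ) ^ 2 - 2 < 0 := by linarith [beta_root]
  exact_mod_cast this

theorem iterate_succ_gt {a c : ℚ} (hc : c = -a - a ^ 2)
    (ha : a ∈ Set.Iio (-2) ∪ Set.Ioo (-2) (-1) ∪ Set.Ioo (-1) 0 ∪ Set.Ioi 1) (n : ℕ) :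
    a < (fun x => x ^ 2 + c)^[n + 1] c := by
  rw [Function.iterate_succ_apply']
  rcases ha with ((ha | ha) | ha) | ha
  · -- The orbit stays beyond the positive fixed point `-a`.
    rw [Set.mem_Iio] at ha
    suffices h : a ^ 2 < ((fun x => x ^ 2 + c)^[n] c) ^ 2 by
      change a < _ ^ 2 + c
      linarith
    induction n with
    | zero =>
      simp only [Function.iterate_zero, id]
      have h2 : c < a := by rw [hc]; nlinarith
      nlinarith
    | succ n ih =>
      rw [Function.iterate_succ_apply']
      set x := (fun x => x ^ 2 + c)^[n] c
      have h1 : -a < x ^ 2 + c := by linarith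
      nlinarith
  · obtain ⟨ha, ha'⟩ := ha
    have h : a < c := by rw [hc]; nlinarith
    change a < _ ^ 2 + c
    nlinarith [sq_nonneg ((fun x => x ^ 2 + c)^[n] c)]
  · obtain ⟨ha, ha'⟩ := ha
    have h : a < c := by rw [hc]; nlinarith
    change a < _ ^ 2 + c
    nlinarith [sq_nonneg ((fun x => x ^ 2 + c)^[n] c)]
  · -- The orbit stays beyond the positive fixed point `1 + a`.
    rw [Set.mem_Ioi] at ha
    suffices h : (1 + a) ^ 2 < ((fun x => x ^ 2 + c)^[n] c) ^ 2 by
      change a < _ ^ 2 + c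
      nlinarith
    induction n with
    | zero =>
      simp only [Function.iterate_zero, id]
      have : c = -(a * (1 + a)) := by rw [hc]; ring
      rw [this, neg_sq]
      exact pow_lt_pow_left₀ (by nlinarith) (by linarith) two_ne_zero
    | succ n ih =>
      rw [Function.iterate_succ_apply']
      set x := (fun x => x ^ 2 + c)^[n] c
      have h1 : 1 + a < x ^ 2 + c := by rw [hc]; nlinarith
      exact pow_lt_pow_left₀ h1 (by linarith) two_ne_zero

theorem iterate_succ_lt {a c : ℚ} (hc : c = -a - a ^ 2) (ha : 0 < a)
    (hβ : a ^ 3 + 2 * a ^ 2 - 2 < 0) (n : ℕ) :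
    (fun x => x ^ 2 + c)^[n + 1] c < a := by
  -- The interval `[c, c ^ 2 + c]` is stable under `f`, and it lies to the left of `a`.
  have h1 : c ^ 2 + c < a := by
    have : c ^ 2 + c - a = a * (a ^ 3 + 2 * a ^ 2 - 2) := by rw [hc]; ring
    nlinarith
  have h2 : c < 0 := by rw [hc]; nlinarith
  have h3 : a < -c := by rw [hc]; nlinarith
  have h : ∀ n, c ≤ (fun x => x ^ 2 + c)^[n] c ∧ (fun x => x ^ 2 + c)^[n] c ≤ -c := by
    intro n
    induction n with
    | zero => exact ⟨le_rfl, by simp only [Function.iterate_zero, id]; linarith⟩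
    | succ n ih =>
      rw [Function.iterate_succ_apply']
      set x := (fun x => x ^ 2 + c)^[n] c
      have : x ^ 2 ≤ c ^ 2 := by nlinarith [ih.1, ih.2]
      exact ⟨by nlinarith, by linarith⟩
  rw [Function.iterate_succ_apply']
  set x := (fun x => x ^ 2 + c)^[n] c with hx
  change x ^ 2 + c < a
  have : x ^ 2 ≤ c ^ 2 := by nlinarith [(h n).1, (h n).2]
  linarith

/-! ### Independence of the critical differences modulo squares -/

/-- The numerator of `critDiff c a n` over the square denominator `denRoot s n ^ 2`. -/
theorem critDiff_eq {r s : ℤ} (hs : s ≠ 0) {a c : ℚ} (ha : a = r / s) (hc : c = -a - a ^ 2)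
    (n : ℕ) :
    critDiff c a n =
      ((if n = 0 then -1 else 1) * (r * num r s n) : ℤ) / (denRoot s n : ℚ) ^ 2 := by
  have h1 : (denRoot s n : ℚ) ^ 2 = s * den s n := by exact_mod_cast denRoot_sq s n
  have h2 := iterate_sub_eq hs ha hc n
  rw [h1]
  unfold critDiff
  split_ifs with hn
  · subst hn
    rw [Function.iterate_zero, id] at h2
    rw [← neg_sub, h2]
    push_cast
    ring
  · rw [h2]
    push_cast
    ring

/-- Let `W` be an odd number with `num r s n = 2 ^ e * W`. It is coprime to `r`, to `2` and to all
earlier numerators, so it has to be a square up to sign if `critDiff c a n` is a square up to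
earlier critical differences. Then `r * num r s n` is a square times `± 2 ^ e * |r|`, with the sign
of `critDiff c a n`, which contradicts the congruence conditions. -/
theorem not_isSquare_critDiff_mul_prod {r s : ℤ} (hs : s ≠ 0) (hrs : IsCoprime r s) {a c : ℚ}
    (ha : a = r / s) (hc : c = -a - a ^ 2) {δ e : ℕ} {ε : ℤ} (hε : ε = (-1) ^ δ * 2 ^ e * |r|)
    (hsign : ∀ n, 0 < (-1) ^ δ * critDiff c a (n + 1))
    (hpar : ∀ n, ∃ w, num r s (n + 1) = 2 ^ e * w ∧ Odd w)
    (hcong : ε ≡ 2 [ZMOD 3] ∨ ε ≡ 3 [ZMOD 4] ∨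
      ∃ q : ℕ, q.Prime ∧ (q : ℤ) ∣ s ∧ ¬ IsSquare (ε : ZMod q))
    (hsq : ¬ IsSquare (a - c)) (n : ℕ) (S : Finset ℕ) (hS : S ⊆ Finset.range n) :
    ¬ IsSquare (critDiff c a n * ∏ i ∈ S, critDiff c a i) := by
  cases n with
  | zero =>
    obtain rfl : S = ∅ := Finset.subset_empty.1 hS
    simpa [critDiff] using hsq
  | succ n =>
    rintro ⟨x, hx⟩
    obtain ⟨w, hw, hodd⟩ := hpar n
    set P : ℤ := ∏ i ∈ S, (if i = 0 then -1 else 1) * (r * num r s i) with hP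
    have hT : ∀ i, (denRoot s i : ℚ) ≠ 0 := fun i => by exact_mod_cast denRoot_ne_zero hs i
    -- Clearing the square denominators, the relation becomes one between integers.
    have hprod : ((r * num r s (n + 1) * P : ℤ) : ℚ) =
        (x * denRoot s (n + 1) * ∏ i ∈ S, (denRoot s i : ℚ)) *
          (x * denRoot s (n + 1) * ∏ i ∈ S, (denRoot s i : ℚ)) := by
      have h1 : ∀ i, ((((if i = 0 then -1 else 1) * (r * num r s i) : ℤ)) : ℚ) =
          critDiff c a i * (denRoot s i : ℚ) ^ 2 := fun i => by
        rw [critDiff_eq hs ha hc, div_mul_cancel₀ _ (pow_ne_zero 2 (hT i))]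
      have h2 := h1 (n + 1)
      rw [if_neg n.succ_ne_zero, one_mul] at h2
      rw [Int.cast_mul, h2, hP, Int.cast_prod, Finset.prod_congr rfl fun i _ => h1 i,
        Finset.prod_mul_distrib, Finset.prod_pow]
      linear_combination (denRoot s (n + 1) : ℚ) ^ 2 * (∏ i ∈ S, (denRoot s i : ℚ)) ^ 2 * hx
    obtain ⟨z, hz⟩ := Rat.isSquare_intCast_iff.1 ⟨_, hprod⟩
    have hwn : w ∣ num r s (n + 1) := hw ▸ dvd_mul_left _ _
    have hcop : IsCoprime w (r * 2 ^ e * P) := by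
      refine IsCoprime.mul_right (IsCoprime.mul_right ?_ ?_) (IsCoprime.prod_right fun i hi => ?_)
      · exact (isCoprime_of_dvd_num hrs hwn hodd n.succ_pos).of_mul_right_left
      · apply IsCoprime.pow_right
        obtain ⟨k, rfl⟩ := hodd
        exact ⟨1, -k, by ring⟩
      · refine IsCoprime.mul_right ?_
          (isCoprime_of_dvd_num hrs hwn hodd (Finset.mem_range.1 (hS hi)))
        split_ifs
        · exact isCoprime_one_right.neg_right
        · exact isCoprime_one_right
    obtain ⟨y, hy⟩ := Int.sq_of_isCoprime hcop (c := z) (by rw [hw] at hz; linear_combination hz)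
    refine mul_num_succ_ne hrs hε hcong n y ?_
    have hpos : 0 < (-1) ^ δ * (r * num r s (n + 1)) := by
      have h1 := hsign n
      rw [critDiff_eq hs ha hc, if_neg n.succ_ne_zero, one_mul, ← mul_div_assoc] at h1
      have h2 := (div_pos_iff_of_pos_right (by have := hT (n + 1); positivity)).1 h1
      exact_mod_cast h2
    have habs : |r * num r s (n + 1)| = 2 ^ e * |r| * y ^ 2 := by
      rw [hw, abs_mul, abs_mul, abs_pow, abs_two]
      have : |w| = y ^ 2 := by
        rcases hy with rfl | rfl
        · exact abs_of_nonneg (sq_nonneg y)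
        · rw [abs_neg]; exact abs_of_nonneg (sq_nonneg y)
      rw [this]
      ring
    have hδ : ((-1 : ℤ) ^ δ) * (-1) ^ δ = 1 := by rw [← mul_pow]; simp
    have habs' : |r * num r s (n + 1)| = (-1) ^ δ * (r * num r s (n + 1)) := by
      rw [← abs_of_pos hpos, abs_mul ((-1) ^ δ), abs_pow, abs_neg, abs_one, one_pow, one_mul]
    rw [habs] at habs'
    rw [hε]
    linear_combination -((-1 : ℤ) ^ δ) * habs' - r * num r s (n + 1) * hδ

/-- The exponent `e` is the `2`-adic valuation of the numerators with positive index. -/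
theorem exists_num_succ_eq_two_pow_mul_odd {r s : ℤ} (hs : s ≠ 0) (hrs : IsCoprime r s) {a : ℚ}
    (ha : a = r / s) (ha0 : a ≠ 0) {e : ℕ}
    (he : (padicValRat 2 a ≤ 0 ∧ e = 0) ∨ (0 < padicValRat 2 a ∧ e = 1)) (n : ℕ) :
    ∃ w, num r s (n + 1) = 2 ^ e * w ∧ Odd w := by
  have hr : r ≠ 0 := by
    rintro rfl
    exact ha0 (by simp [ha])
  have hval : padicValRat 2 a = padicValInt 2 r - padicValInt 2 s := by
    rw [ha, padicValRat.div (by exact_mod_cast hr) (by exact_mod_cast hs), padicValRat.of_int,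
      padicValRat.of_int]
  have hodd : ∀ x : ℤ, Odd x → padicValInt 2 x = 0 := fun x hx =>
    padicValInt.eq_zero_of_not_dvd fun h => by
      obtain ⟨k, hk⟩ := hx
      obtain ⟨l, hl⟩ := h
      push_cast at hl
      omega
  rcases Int.even_or_odd r with h | h
  · have hs' : Odd s := by
      by_contra hs'
      rw [Int.not_odd_iff_even] at hs'
      obtain ⟨u, v, huv⟩ := hrs
      obtain ⟨k, rfl⟩ := h
      obtain ⟨l, rfl⟩ := hs'
      have : 2 * (u * k + v * l) = 1 := by linear_combination huv
      omega
    have hpos : padicValInt 2 r ≠ 0 := fun h0 => by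
      rcases padicValInt.eq_zero_iff.1 h0 with h1 | h1 | h1
      · omega
      · exact hr h1
      · exact h1 (by exact_mod_cast h.two_dvd)
    rw [hodd s hs'] at hval
    have : e = 1 := by omega
    rw [this, pow_one]
    exact exists_num_succ_eq_two_mul_odd h hs' n
  · rw [hodd r h] at hval
    have : e = 0 := by omega
    exact ⟨_, by rw [this, pow_zero, one_mul], odd_num h _⟩

end Arboreal

theorem theorem1p1 (a c : ℚ) (f : Polynomial ℚ)
    (hc : c = -a - a ^ 2)
    (hf : f = Polynomial.X ^ 2 + Polynomial.C c)
    (r s : ℤ) (hs : 0 < s) (hrs : Int.gcd r s = 1) (hars : a = (r : ℚ) / (s : ℚ))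
    (δ e : ℕ)
    (hδ : (a ∈ Set.Iio (-2) ∪ Set.Ioo (-2) (-1) ∪ Set.Ioo (-1) 0 ∪ Set.Ioi 1 ∧ δ = 0) ∨
      ((a : ℝ) ∈ Set.Ioo 0 Arboreal.beta ∧ δ = 1))
    (he : (padicValRat 2 a ≤ 0 ∧ e = 0) ∨ (0 < padicValRat 2 a ∧ e = 1))
    (hsq : ¬ IsSquare (a - c))
    (h : (-1) ^ δ * 2 ^ e * |r| ≡ 2 [ZMOD 3] ∨
      (-1) ^ δ * 2 ^ e * |r| ≡ 3 [ZMOD 4] ∨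
      ∃ q : ℕ, q.Prime ∧ (q : ℤ) ∣ s ∧
        ¬ IsSquare (((-1) ^ δ * 2 ^ e * |r| : ℤ) : ZMod q)) :
    Arboreal.IsRegularTree 2 f a ∧ Function.Surjective (Arboreal.arborealRep f a) := by
  subst hf
  have hcop := Int.isCoprime_iff_gcd_eq_one.2 hrs
  have ha0 : a ≠ 0 := by
    rintro rfl
    exact hsq ⟨0, by rw [hc]; norm_num⟩
  have hsign : ∀ n, 0 < (-1) ^ δ * Arboreal.critDiff c a (n + 1) := by
    intro n
    rw [Arboreal.critDiff, if_neg n.succ_ne_zero]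
    rcases hδ with ⟨ha, rfl⟩ | ⟨ha, rfl⟩
    · linarith [Arboreal.iterate_succ_gt hc ha n]
    · have hpos : 0 < a := by exact_mod_cast ha.1
      linarith [Arboreal.iterate_succ_lt hc hpos (Arboreal.cubic_neg_of_lt_beta hpos ha.2) n]
  have hD := Arboreal.not_isSquare_critDiff_mul_prod hs.ne' hcop hars hc rfl hsign
    (Arboreal.exists_num_succ_eq_two_pow_mul_odd hs.ne' hcop hars ha0 he) h hsq
  exact ⟨Arboreal.isRegularTree_two fun n h0 => hD n ∅ (by simp) (by simp [h0]),
    Arboreal.surjective_arborealRep hD⟩
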